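/- Let $p$ be an odd prime, let $m,s$ be positive integers, and let $\mathcal R=\mathbb F_{p^m}[u,v]/\langle u^2,v^2,uv-vu\rangle$. Let $\alpha=\alpha_1+\alpha_2u+\alpha_3v+\alpha_4uv\in\mathcal R$ with $\alpha_1,\alpha_2,\alpha_3\in\mathbb F_{p^m}^{*}$ and $\alpha_4\in\mathbb F_{p^m}$, and suppose that $\alpha$ is not a square in $\mathcal R$. Let $\alpha_0=\alpha_1^{p^{m-r_0}}$, where $r_0$ is the remainder of $s$ on division by $m$, so that $\alpha_0^{p^s}=\alpha_1$. Put $\mathcal R_\alpha=\mathcal R[x]/\langle x^{2p^s}-\alpha\rangle$, whose ideals are identified with the $\alpha$-constacyclic codes of length $2p^s$ over $\mathcal R$ (the class of $c_0+c_1x+\dots+c_{2p^s-1}x^{2p^s-1}$ corresponds to the word $(c_0,\dots,c_{2p^s-1})$), and let $d_H$ denote the Hamming distance of a code. Let $$\mathcal C=\langle (x^2-\alpha_0)^\ell+u(x^2-\alpha_0)^t z(x)\rangle\subseteq\mathcal R_\alpha,$$ where $0\le \ell\le 2p^s-1$, $0\le t<\ell$, and $z(x)\in\mathcal R_\alpha$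 is $0$ or a unit. Then there is a least integer $\Im\ge 0$ such that $u(x^2-\alpha_0)^{\Im}\in\mathcal C$, and $d_H(\mathcal C)=d_H(\langle u(x^2-\alpha_0)^{\Im}\rangle)$. Moreover, $$d_H(\mathcal C)=\begin{cases}1 & \text{if } 0\le\Im\le p^s,\\ (\Gamma+1)p^{\gamma} & \text{if } 2p^s-p^{s-\gamma}+(\Gamma-1)p^{s-\gamma-1}+1\le\Im\le 2p^s-p^{s-\gamma}+\Gamma p^{s-\gamma-1},\end{cases}$$ where in the second case $1\le\Gamma\le p-1$ and $0\le\gamma\le s-1$ are integers; and these cases are exhaustive, i.e. $\Im\le p^s$ or $\Im$ lies in one of the ranges of the second case. -/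

import Mathlib

open Polynomial

noncomputable section

namespace Constacyclic

/-- The ring `R = F[u, v] / ⟨u², v², uv - vu⟩ = F + uF + vF + uvF`, realised as the dual numbers
(adjoining `u` with `u² = 0`) over the dual numbers `F + vF` (adjoining `v` with `v² = 0`). -/
def R (F : Type*) [Field F] : Type _ := DualNumber (DualNumber F)

instance instCommRingR (F : Type*) [Field F] : CommRing (R F) :=
  inferInstanceAs (CommRing (DualNumber (DualNumber F)))

section BaseRing

variable {F : Type*} [Field F]

/-- The inclusion of the scalars `F` in `R`. -/
def cst (a : F) : R F := TrivSqZeroExt.inl (TrivSqZeroExt.inl a)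

/-- The element `u` of `R`. -/
def u : R F := DualNumber.eps

/-- The element `v` of `R`. -/
def v : R F := TrivSqZeroExt.inl DualNumber.eps

/-- The element `a₁ + a₂ u + a₃ v + a₄ uv` of `R`. -/
def elt (a₁ a₂ a₃ a₄ : F) : R F :=
  cst a₁ + cst a₂ * u + cst a₃ * v + cst a₄ * (u * v)

theorem fst_mul (x y : R F) : (x * y).fst = x.fst * y.fst :=
  TrivSqZeroExt.fst_mul x y

theorem snd_mul (x y : R F) : (x * y).snd = x.fst * y.snd + x.snd * y.fst := by
  refine (TrivSqZeroExt.snd_mul (R := DualNumber F) (M := DualNumber F) x y).trans ?_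
  rw [smul_eq_mul, op_smul_eq_mul]

theorem fst_add (x y : R F) : (x + y).fst = x.fst + y.fst := rfl

theorem snd_add (x y : R F) : (x + y).snd = x.snd + y.snd := rfl

theorem u_mul_u : (u * u : R F) = 0 := DualNumber.eps_mul_eps (R := DualNumber F)

theorem v_mul_v : (v * v : R F) = 0 := by
  apply TrivSqZeroExt.ext
  · rw [fst_mul]; exact DualNumber.eps_mul_eps (R := F)
  · rw [snd_mul]
    show DualNumber.eps * (0 : DualNumber F) + 0 * DualNumber.eps = 0
    simp

theorem fst_elt (a b c d : F) :
    (elt a b c d).fst = (TrivSqZeroExt.inl a + TrivSqZeroExt.inr c : DualNumber F) := by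
  have hu : (u : R F).fst = 0 := rfl
  have hv : (v : R F).fst = DualNumber.eps := rfl
  have hc (x : F) : (cst x : R F).fst = TrivSqZeroExt.inl x := rfl
  simp only [elt, fst_add, fst_mul, hu, hv, hc]
  ext <;> simp

theorem snd_elt (a b c d : F) :
    (elt a b c d).snd = (TrivSqZeroExt.inl b + TrivSqZeroExt.inr d : DualNumber F) := by
  have hu : (u : R F).fst = 0 := rfl
  have hv : (v : R F).fst = DualNumber.eps := rfl
  have hc (x : F) : (cst x : R F).fst = TrivSqZeroExt.inl x := rfl
  have hu' : (u : R F).snd = 1 := rfl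
  have hv' : (v : R F).snd = 0 := rfl
  have hc' (x : F) : (cst x : R F).snd = 0 := rfl
  simp only [elt, snd_add, snd_mul, fst_mul, hu, hv, hc, hu', hv', hc']
  ext <;> simp

/-- Every element of `R` is `a₁ + a₂ u + a₃ v + a₄ uv` for exactly one `(a₁, a₂, a₃, a₄)`. -/
theorem elt_bijective :
    Function.Bijective (fun a : F × F × F × F => elt a.1 a.2.1 a.2.2.1 a.2.2.2) := by
  constructor
  · rintro ⟨a, b, c, d⟩ ⟨a', b', c', d'⟩ h
    have h1 := congrArg (fun r : R F => r.fst) h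
    have h2 := congrArg (fun r : R F => r.snd) h
    simp only [fst_elt, snd_elt] at h1 h2
    have h3 := congrArg TrivSqZeroExt.fst h1
    have h4 := congrArg TrivSqZeroExt.snd h1
    have h5 := congrArg TrivSqZeroExt.fst h2
    have h6 := congrArg TrivSqZeroExt.snd h2
    simp at h3 h4 h5 h6
    simp [h3, h4, h5, h6]
  · intro r
    refine ⟨(r.fst.fst, r.snd.fst, r.fst.snd, r.snd.snd), ?_⟩
    apply TrivSqZeroExt.ext
    · rw [fst_elt]; exact TrivSqZeroExt.inl_fst_add_inr_snd_eq _
    · rw [snd_elt]; exact TrivSqZeroExt.inl_fst_add_inr_snd_eq _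

end BaseRing

section Codes

variable {A : Type*} [CommRing A]

/-- The ambient ring `A[x] / ⟨xⁿ - α⟩` of the `α`-constacyclic codes of length `n` over `A`. -/
abbrev Ambient (n : ℕ) (α : A) : Type _ := AdjoinRoot (X ^ n - C α : A[X])

/-- The polynomial representation `c₀ + c₁ x + ⋯ + cₙ₋₁ xⁿ⁻¹` of a word `c` of length `n`. -/
def polyRep (n : ℕ) (α : A) (c : Fin n → A) : Ambient n α :=
  ∑ i : Fin n, AdjoinRoot.of (X ^ n - C α : A[X]) (c i) *
    AdjoinRoot.root (X ^ n - C α : A[X]) ^ (i : ℕ)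

/-- The constacyclic code in `Aⁿ` that corresponds to an ideal of the ambient ring. -/
def code {n : ℕ} {α : A} (I : Ideal (Ambient n α)) : Set (Fin n → A) :=
  {c | polyRep n α c ∈ I}

open Classical in
/-- The Hamming distance of a code: the minimum of `d_H(x, y)` over distinct codewords `x, y`
(with value `0` for a code with fewer than two words). -/
def minDist {n : ℕ} (K : Set (Fin n → A)) : ℕ :=
  sInf {d | ∃ x ∈ K, ∃ y ∈ K, x ≠ y ∧ hammingDist x y = d}

/-- The Hamming distance `d_H` of the constacyclic code given by an ideal. -/
def dH {n : ℕ} {α : A} (I : Ideal (Ambient n α)) : ℕ := minDist (code I)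

end Codes

section Generators

variable {F : Type*} [Field F]

/-- The element `α₀ = α₁ ^ (p ^ (m - r₀))` of `F`, where `r₀` is the remainder of `s` modulo `m`.
If `F` has `p ^ m` elements then `α₀` is the `p ^ s`-th root of `α₁`. -/
def alpha0 (p m s : ℕ) (α₁ : F) : F := α₁ ^ (p ^ (m - s % m))

/-- The image of `u` in the ambient ring `R[x] / ⟨xⁿ - α⟩`. -/
def uBar (n : ℕ) (α : R F) : Ambient n α := AdjoinRoot.of (X ^ n - C α : (R F)[X]) (u : R F)

/-- The element `x² - a` of the ambient ring `R[x] / ⟨xⁿ - α⟩`, for a scalar `a`. -/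
def quad (n : ℕ) (α : R F) (a : F) : Ambient n α :=
  AdjoinRoot.root (X ^ n - C α : (R F)[X]) ^ 2 - AdjoinRoot.of (X ^ n - C α : (R F)[X]) (cst a)

end Generators

/-- The range of `i` that belongs to the parameters `Γ` and `γ`:
`2p^s - p^(s-γ) + (Γ-1)p^(s-γ-1) + 1 ≤ i ≤ 2p^s - p^(s-γ) + Γp^(s-γ-1)`
where `1 ≤ Γ ≤ p - 1` and `0 ≤ γ ≤ s - 1`. -/
def InRange (p s Γ γ i : ℕ) : Prop :=
  1 ≤ Γ ∧ Γ ≤ p - 1 ∧ γ < s ∧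
    2 * p ^ s - p ^ (s - γ) + (Γ - 1) * p ^ (s - γ - 1) + 1 ≤ i ∧
    i ≤ 2 * p ^ s - p ^ (s - γ) + Γ * p ^ (s - γ - 1)

end Constacyclic

end

/-! Write `h = X² - α₀`. Since 2 is invertible, an element of `R` with nonzero square constant term
is a square; hence `α₀` is not a square in `F` and `h` is irreducible. Frobenius gives `h ^ p^s =
x^(2p^s) - α₁ = α₂u + α₃v + α₄uv` in the ambient ring, so `u h^(p^s) = α₃uv` and `u h^(2p^s) = 0`.
As `α₃ ≠ 0`, `v` can be traded for a power of `h` after multiplication by `u`: every multiple of `u`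
is `u g` with `g` in `F[X]`, and by Bézout the part of `K` inside `⟨u⟩` is `⟨u h^i⟩`
(`uBar_mul_scalarPoly_mem_span`).

Only this part matters for the distance: multiplication by `u` does not raise weights, and a word
killed by `u` is already a multiple of `u` (`dH_eq_dH_span_uBar_mul`).

If `i ≤ p^s`, the code contains the constant `α₃uv`, of weight 1. If `i = p^s + j`, the words are
`uv r` with `h^j ∣ r` and `deg r < 2p^s`, so the question is how few terms such an `r` over `F` can
have. The lower bound is `le_card_support_of_pow_dvd`; a power of `h` attains it
(`card_support_pow_le`). -/

namespace Constacyclic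

/-! ### Numbers of terms of multiples of powers of `X^e - a` in characteristic `p` -/

section Weights

variable {F : Type*} [Field F]

/-- The operator `X d/dX - n₀` kills the term of degree `n₀`, creates no new term, and costs only
one factor `X - b`; induction on `k` follows. -/
theorem lt_card_support_of_pow_dvd {b : F} (hb : b ≠ 0) (k : ℕ) :
    ∀ r : F[X], r ≠ 0 → Set.InjOn (Nat.cast : ℕ → F) r.support → (X - C b) ^ k ∣ r →
      k < r.support.card := by
  induction k with
  | zero =>
    intro r hr _ _
    exact Finset.card_pos.2 (support_nonempty.2 hr)
  | succ k ih =>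
    intro r hr hinj hdvd
    obtain ⟨n₀, hn₀⟩ := support_nonempty.2 hr
    set q : F[X] := X * derivative r - C (n₀ : F) * r with hq
    have hcoeff (n : ℕ) : q.coeff n = ((n : F) - n₀) * r.coeff n := by
      rw [hq, coeff_sub, coeff_C_mul]
      cases n with
      | zero => simp
      | succ n => rw [coeff_X_mul, coeff_derivative]; push_cast; ring
    have hsub : q.support ⊆ r.support.erase n₀ := by
      intro n hn
      rw [mem_support_iff, hcoeff] at hn
      rw [Finset.mem_erase, mem_support_iff]
      refine ⟨?_, right_ne_zero_of_mul hn⟩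
      rintro rfl
      simp at hn
    have hcard : q.support.card < r.support.card :=
      (Finset.card_le_card hsub).trans_lt (Finset.card_erase_lt_of_mem hn₀)
    -- By injectivity of the cast, `q = 0` would leave `r` a monomial, which cannot vanish at `b ≠
    -- 0`.
    have hq0 : q ≠ 0 := by
      intro h0
      have hs : r.support = {n₀} := by
        ext n
        rw [Finset.mem_singleton]
        refine ⟨fun hn => ?_, fun h => h ▸ hn₀⟩
        have h1 := hcoeff n
        rw [h0, coeff_zero] at h1
        have h2 := (mul_eq_zero.1 h1.symm).resolve_right (mem_support_iff.1 hn)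
        exact hinj hn hn₀ (sub_eq_zero.1 h2)
      have hroot : r.eval b = 0 :=
        dvd_iff_isRoot.1 ((dvd_pow_self _ k.succ_ne_zero).trans hdvd)
      rw [eval_eq_sum, sum_def, hs, Finset.sum_singleton] at hroot
      exact (mul_ne_zero (mem_support_iff.1 hn₀) (pow_ne_zero _ hb)) hroot
    have hqd : (X - C b) ^ k ∣ q := by
      refine dvd_sub (Dvd.dvd.mul_left ?_ _) (Dvd.dvd.mul_left ((pow_dvd_pow _ k.le_succ).trans hdvd) _)
      obtain ⟨g, rfl⟩ := hdvd
      rw [derivative_mul, derivative_X_sub_C_pow]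
      refine dvd_add ?_ ?_
      · simp only [Nat.add_sub_cancel]
        exact Dvd.dvd.mul_right (Dvd.dvd.mul_left dvd_rfl _) _
      · exact Dvd.dvd.mul_right (pow_dvd_pow _ k.le_succ) _
    have := ih q hq0 (hinj.mono fun n hn => Finset.mem_of_mem_erase (hsub hn)) hqd
    omega

/-- The window is `1, …, p` because the shift by `d ≥ 1` below puts the exponents there. -/
theorem natCast_injOn_Icc (p : ℕ) [CharP F p] : Set.InjOn (Nat.cast : ℕ → F) (Set.Icc 1 p) := by
  have key : ∀ a b : ℕ, 1 ≤ a → b ≤ p → a ≤ b → (a : F) = b → a = b := by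
    intro a b ha hb hab h
    have h1 := (Nat.modEq_iff_dvd' hab).1 ((CharP.natCast_eq_natCast F p).1 h)
    have := Nat.eq_zero_of_dvd_of_lt h1 (by omega)
    omega
  intro a ha b hb h
  rcases le_total a b with hab | hab
  · exact key a b ha.1 hb.2 hab h
  · exact (key b a hb.1 ha.2 hab h.symm).symm

/-- One residue class of exponents mod `N`, read as a polynomial `q` in `X^N`, inherits the factor
`(X - b)^k` and so has at least `k + 1` terms. One more term comes either from another residue class
or, if there is none, from the factor `h`, which then forces another factor `X - b` of `q`. -/
theorem lt_card_support_of_X_pow_sub_C_pow_mul_dvd (p : ℕ) [CharP F p] {N k : ℕ} (hN : 0 < N) {b : F}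
    (hb : b ≠ 0) {h r : F[X]} (hh : h ∣ X ^ N - C b) (hu : ¬ IsUnit h) (hr : r ≠ 0)
    (hdeg : r.natDegree < p * N) (hdvd : (X ^ N - C b) ^ k * h ∣ r) :
    k + 1 < r.support.card := by
  obtain ⟨n₁, hn₁⟩ := support_nonempty.2 hr
  have hmod := Nat.mod_lt n₁ hN
  obtain ⟨d, hd⟩ : ∃ d, d = N - n₁ % N := ⟨_, rfl⟩
  have hd1 : 1 ≤ d := by omega
  have hdN : d ≤ N := by omega
  obtain ⟨c, hc⟩ : N ∣ d + n₁ := by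
    refine ⟨n₁ / N + 1, ?_⟩
    have := Nat.div_add_mod n₁ N
    rw [mul_add]
    omega
  set q : F[X] := contract N (X ^ d * r) with hq
  have hqc (n : ℕ) : q.coeff n = if d ≤ n * N then r.coeff (n * N - d) else 0 := by
    rw [hq, coeff_contract hN.ne', coeff_X_pow_mul']
  have hqs {n : ℕ} (hn : n ∈ q.support) : d ≤ n * N ∧ n * N - d ∈ r.support := by
    rw [mem_support_iff, hqc] at hn
    split_ifs at hn with hle
    · exact ⟨hle, mem_support_iff.2 hn⟩
    · exact absurd rfl hn
  have hq0 : q ≠ 0 := by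
    intro h0
    have h1 := hqc c
    rw [h0, coeff_zero, mul_comm c N, ← hc, if_pos (Nat.le_add_right _ _),
      Nat.add_sub_cancel_left] at h1
    exact mem_support_iff.1 hn₁ h1.symm
  have hinj : Set.InjOn (Nat.cast : ℕ → F) q.support := by
    refine (natCast_injOn_Icc p).mono fun n hn => ?_
    obtain ⟨h1, h2⟩ := hqs hn
    have h3 := le_natDegree_of_mem_supp _ h2
    constructor
    · rcases Nat.eq_zero_or_pos n with rfl | h
      · omega
      · exact h
    · by_contra hlt
      have : (p + 1) * N ≤ n * N := Nat.mul_le_mul_right _ (by omega)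
      rw [add_mul] at this
      omega
  have hexp : (X ^ N - C b : F[X]) = expand F N (X - C b) := by simp
  have himg : Set.InjOn (fun n => n * N - d) (q.support : Set ℕ) := by
    intro n hn n' hn' hnn
    have h1 := (hqs hn).1
    have h2 := (hqs hn').1
    simp only at hnn
    exact Nat.eq_of_mul_eq_mul_right hN (by omega : n * N = n' * N)
  obtain ⟨g, hg⟩ := hdvd
  have hqk : (X - C b) ^ k ∣ q := by
    refine ⟨contract N (X ^ d * (h * g)), ?_⟩
    rw [mul_comm, ← contract_mul_expand hN.ne', map_pow, ← hexp, hq, hg]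
    congr 1
    ring
  by_cases hall : ∃ n₂ ∈ r.support, ¬ N ∣ d + n₂
  · obtain ⟨n₂, hn₂, hnd⟩ := hall
    have h1 := lt_card_support_of_pow_dvd hb k q hq0 hinj hqk
    have h2 : q.support.card ≤ (r.support.erase n₂).card := by
      refine Finset.card_le_card_of_injOn (fun n => n * N - d) (fun n hn => ?_) himg
      obtain ⟨h3, h4⟩ := hqs hn
      refine Finset.mem_erase.2 ⟨fun h5 => hnd ⟨n, ?_⟩, h4⟩
      rw [mul_comm N n]
      simp only at h5
      omega
    rw [Finset.card_erase_of_mem hn₂] at h2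
    omega
  · push Not at hall
    have h2 : q.support.card ≤ r.support.card :=
      Finset.card_le_card_of_injOn (fun n => n * N - d) (fun n hn => (hqs hn).2) himg
    have hE : expand F N q = X ^ d * r := by
      ext n
      rw [coeff_expand hN, coeff_X_pow_mul']
      by_cases hle : d ≤ n
      · rw [if_pos hle]
        by_cases hNn : N ∣ n
        · rw [if_pos hNn, hqc, Nat.div_mul_cancel hNn, if_pos hle]
        · rw [if_neg hNn]
          by_contra hne
          have := hall _ (mem_support_iff.2 (Ne.symm hne))
          rw [Nat.add_sub_cancel' hle] at this
          exact hNn this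
      · rw [if_neg hle]
        split_ifs with hNn
        · rw [hqc, Nat.div_mul_cancel hNn, if_neg hle]
        · rfl
    obtain ⟨q', hq'⟩ := hqk
    have hne : (X ^ N - C b : F[X]) ^ k ≠ 0 := pow_ne_zero _ (X_pow_sub_C_ne_zero hN b)
    have hE' : expand F N q' = X ^ d * (h * g) := by
      refine mul_left_cancel₀ hne ?_
      rw [hq', map_mul, map_pow, ← hexp, hg] at hE
      rw [hE]
      ring
    have hroot : (X - C b) ∣ q' := by
      have h3 : (X - C b) ∣ q' - C (q'.eval b) := by
        rw [dvd_iff_isRoot]; simp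
      have h4 := map_dvd (expand F N) h3
      rw [← hexp, map_sub, expand_C, hE'] at h4
      -- `h` divides `q'(X^N)` and, through `X^N - b`, also `q'(X^N) - q'(b)`; a nonunit dividing a
      -- constant makes it zero.
      have h5 : h ∣ C (q'.eval b) := by
        have h6 := dvd_sub (Dvd.intro_left (X ^ d * g) (by ring) : h ∣ X ^ d * (h * g)) (hh.trans h4)
        simpa using h6
      rw [dvd_iff_isRoot]
      by_contra h7
      exact hu (isUnit_of_dvd_unit h5 (isUnit_C.2 (isUnit_iff_ne_zero.2 h7)))
    have h8 : (X - C b) ^ (k + 1) ∣ q := by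
      rw [hq', pow_succ]
      exact mul_dvd_mul_left _ hroot
    have := lt_card_support_of_pow_dvd hb (k + 1) q hq0 hinj h8
    omega

/-- In characteristic `p`, `(X^N - b)^(p-1) = (X^(pN) - b^p) / (X^N - b)` is a geometric sum with
`p` nonzero coefficients, and the shifts of `g` by multiples of `N` do not overlap. -/
theorem card_support_X_pow_sub_C_pow_pred_mul (p : ℕ) [Fact p.Prime] [CharP F p] {N : ℕ} (hN : 0 < N)
    {b : F} (hb : b ≠ 0) {g : F[X]} (hg : g.natDegree < N) :
    p * g.support.card ≤ ((X ^ N - C b) ^ (p - 1) * g).support.card := by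
  have hp := (Fact.out : p.Prime).pos
  have hexp : (X ^ N - C b : F[X]) ^ (p - 1)
      = ∑ i ∈ Finset.range p, C (b ^ (p - 1 - i)) * X ^ (i * N) := by
    refine mul_right_cancel₀ (X_pow_sub_C_ne_zero hN b) ?_
    rw [← pow_succ, Nat.sub_add_cancel hp, sub_pow_char, ← geom_sum₂_mul]
    congr 1
    refine Finset.sum_congr rfl fun i _ => ?_
    rw [C_pow, ← pow_mul, mul_comm N i, mul_comm]
  have hcoeff (k c : ℕ) (hk : k < p) (hc : c < N) :
      ((X ^ N - C b) ^ (p - 1) * g).coeff (c + N * k) = b ^ (p - 1 - k) * g.coeff c := by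
    rw [hexp, Finset.sum_mul, finsetSum_coeff, Finset.sum_eq_single k]
    · rw [mul_assoc, coeff_C_mul, mul_comm k N, coeff_X_pow_mul]
    · intro i _ hik
      rw [mul_assoc, coeff_C_mul, coeff_X_pow_mul', mul_comm i N]
      split_ifs with hle
      · rw [coeff_eq_zero_of_natDegree_lt, mul_zero]
        have hlt : i < k := by
          refine lt_of_le_of_ne ?_ hik
          by_contra hki
          have : N * (k + 1) ≤ N * i := Nat.mul_le_mul_left _ (by omega)
          rw [mul_add] at this
          omega
        have : N * (i + 1) ≤ N * k := Nat.mul_le_mul_left _ (by omega)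
        rw [mul_add] at this
        omega
      · rw [mul_zero]
    · intro h
      exact absurd (Finset.mem_range.2 hk) h
  have : p * g.support.card = (Finset.range p ×ˢ g.support).card := by
    rw [Finset.card_product, Finset.card_range]
  rw [this]
  have hlt {x : ℕ × ℕ} (hx : x ∈ Finset.range p ×ˢ g.support) : x.2 < N :=
    (le_natDegree_of_mem_supp _ (Finset.mem_product.1 hx).2).trans_lt hg
  refine Finset.card_le_card_of_injOn (fun x => x.2 + N * x.1) (fun x hx => ?_) ?_
  · have hx' := Finset.mem_product.1 hx
    rw [Finset.mem_coe, mem_support_iff, hcoeff _ _ (Finset.mem_range.1 hx'.1) (hlt hx)]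
    exact mul_ne_zero (pow_ne_zero _ hb) (mem_support_iff.1 hx'.2)
  · intro x hx y hy hxy
    have hx1 := hlt hx
    have hy1 := hlt hy
    simp only at hxy
    have h1 : x.2 = y.2 := by
      have := congrArg (· % N) hxy
      simpa [Nat.add_mul_mod_self_left, Nat.mod_eq_of_lt hx1, Nat.mod_eq_of_lt hy1] using this
    have h2 : N * x.1 = N * y.1 := by omega
    exact Prod.ext (Nat.eq_of_mul_eq_mul_left hN h2) h1

theorem X_pow_sub_C_pow_char_pow (p : ℕ) [Fact p.Prime] [CharP F p] (e k : ℕ) (a : F) :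
    (X ^ e - C a : F[X]) ^ p ^ k = X ^ (e * p ^ k) - C (a ^ p ^ k) := by
  rw [sub_pow_char_pow, ← pow_mul, C_pow]

/-- Induction on `γ`: each step splits off a factor `(X^M - b)^(p-1)` with a cofactor of degree
below `M`, which multiplies the bound by `p`. -/
theorem le_card_support_of_pow_dvd (p : ℕ) [Fact p.Prime] [CharP F p] {e : ℕ} (he : 0 < e) {a : F}
    (ha : a ≠ 0) {Γ : ℕ} (hΓ : 1 ≤ Γ) (σ γ : ℕ) :
    ∀ r : F[X], r ≠ 0 → r.natDegree < e * p ^ (σ + 1 + γ) →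
      (X ^ e - C a) ^ (p ^ (σ + 1 + γ) - p ^ (σ + 1) + (Γ - 1) * p ^ σ + 1) ∣ r →
      (Γ + 1) * p ^ γ ≤ r.support.card := by
  have hp := (Fact.out : p.Prime).pos
  have hu : ¬ IsUnit (X ^ e - C a : F[X]) := fun h => by
    have := natDegree_eq_zero_of_isUnit h
    rw [natDegree_X_pow_sub_C] at this
    omega
  induction γ with
  | zero =>
    -- Here the divisor is `(X^N - b)^(Γ-1) (X^e - a)` with `N = e p^σ`, `b = a^(p^σ)`; the `+ 1` in
    -- the exponent supplies the extra factor.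
    intro r hr hdeg hdvd
    have h1 := lt_card_support_of_X_pow_sub_C_pow_mul_dvd p (N := e * p ^ σ) (k := Γ - 1)
      (b := a ^ p ^ σ) (h := X ^ e - C a) (r := r) (by positivity) (pow_ne_zero _ ha)
      (by rw [← X_pow_sub_C_pow_char_pow]; exact dvd_pow_self _ (by positivity)) hu hr
      (by rw [add_zero, pow_succ] at hdeg; calc _ < _ := hdeg
            _ = _ := by ring)
      (by
        rw [← X_pow_sub_C_pow_char_pow, ← pow_mul, ← pow_succ, mul_comm (p ^ σ)]
        simpa using hdvd)
    rw [pow_zero, mul_one]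
    omega
  | succ γ ih =>
    intro r hr hdeg hdvd
    have hle : p ^ (σ + 1) ≤ p ^ (σ + 1 + γ) := Nat.pow_le_pow_right hp (by omega)
    have hM : p ^ (σ + 1 + (γ + 1)) = p ^ (σ + 1 + γ) * (p - 1) + p ^ (σ + 1 + γ) := by
      rw [← Nat.mul_succ, Nat.succ_eq_add_one, Nat.sub_add_cancel hp, ← pow_succ]; rfl
    have hsplit : p ^ (σ + 1 + (γ + 1)) - p ^ (σ + 1) + (Γ - 1) * p ^ σ + 1
        = p ^ (σ + 1 + γ) * (p - 1)
          + (p ^ (σ + 1 + γ) - p ^ (σ + 1) + (Γ - 1) * p ^ σ + 1) := by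
      omega
    rw [hsplit, pow_add, pow_mul] at hdvd
    obtain ⟨g, hg⟩ := hdvd
    have hpos : 0 < e * p ^ (σ + 1 + γ) := by positivity
    rw [mul_assoc] at hg
    set g' := (X ^ e - C a) ^ (p ^ (σ + 1 + γ) - p ^ (σ + 1) + (Γ - 1) * p ^ σ + 1) * g with hg'
    rw [X_pow_sub_C_pow_char_pow] at hg
    have hg0 : g' ≠ 0 := by
      rintro h0
      rw [h0, mul_zero] at hg
      exact hr hg
    have hd : g'.natDegree < e * p ^ (σ + 1 + γ) := by
      rw [hg, natDegree_mul (pow_ne_zero _ (X_pow_sub_C_ne_zero hpos _)) hg0, natDegree_pow,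
        natDegree_X_pow_sub_C, hM, mul_add] at hdeg
      have : (p - 1) * (e * p ^ (σ + 1 + γ)) = e * (p ^ (σ + 1 + γ) * (p - 1)) := by ring
      omega
    have h1 := ih g' hg0 hd (Dvd.intro _ rfl)
    have h2 := card_support_X_pow_sub_C_pow_pred_mul p hpos (pow_ne_zero (p ^ (σ + 1 + γ)) ha) hd
    rw [hg]
    calc (Γ + 1) * p ^ (γ + 1) = p * ((Γ + 1) * p ^ γ) := by ring
      _ ≤ p * g'.support.card := Nat.mul_le_mul_left _ h1
      _ ≤ _ := h2

theorem card_support_X_pow_sub_C_pow_le (N k : ℕ) (b : F) :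
    ((X ^ N - C b : F[X]) ^ k).support.card ≤ k + 1 := by
  have h : ((X ^ N - C b : F[X]) ^ k).support ⊆ (Finset.range (k + 1)).image (N * ·) := by
    rw [sub_eq_add_neg, ← C_neg, add_pow]
    intro n hn
    by_contra hni
    refine mem_support_iff.1 hn ?_
    rw [finsetSum_coeff]
    refine Finset.sum_eq_zero fun i hi => ?_
    rw [← pow_mul, ← C_pow, mul_assoc, ← C_eq_natCast, ← C_mul, coeff_mul_C, coeff_X_pow,
      if_neg, zero_mul]
    rintro rfl
    exact hni (Finset.mem_image_of_mem _ hi)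
  exact (Finset.card_le_card h).trans (Finset.card_image_le.trans (by rw [Finset.card_range]))

/-- The exponent is `p^(σ+1) (p^γ - 1) + p^σ Γ`, so Frobenius gives a product of a `(p^γ - 1)`-th
and a `Γ`-th power of binomials. -/
theorem card_support_pow_le (p : ℕ) [Fact p.Prime] [CharP F p] (e : ℕ) (a : F) (Γ σ γ : ℕ) :
    ((X ^ e - C a : F[X]) ^ (p ^ (σ + 1 + γ) - p ^ (σ + 1) + Γ * p ^ σ)).support.card
      ≤ (Γ + 1) * p ^ γ := by
  have hp := (Fact.out : p.Prime).pos
  have h1 : p ^ (σ + 1 + γ) - p ^ (σ + 1) = p ^ (σ + 1) * (p ^ γ - 1) := by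
    rw [Nat.mul_sub, mul_one, pow_add]
  have h2 : p ^ γ - 1 + 1 = p ^ γ := Nat.sub_add_cancel (Nat.pow_pos hp)
  rw [h1, mul_comm Γ, pow_add, pow_mul, pow_mul, X_pow_sub_C_pow_char_pow,
    X_pow_sub_C_pow_char_pow]
  refine card_support_mul_le.trans ?_
  rw [mul_comm]
  refine Nat.mul_le_mul (card_support_X_pow_sub_C_pow_le _ _ _) ?_
  exact (card_support_X_pow_sub_C_pow_le _ _ _).trans h2.le

end Weights

/-! ### Words, polynomial representatives and Hamming distance -/

section Words

variable {A : Type*} [CommRing A]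

theorem polyRep_eq_mk (n : ℕ) (α : A) (c : Fin n → A) :
    polyRep n α c = AdjoinRoot.mk (X ^ n - C α) (∑ i : Fin n, C (c i) * X ^ (i : ℕ)) := by
  simp only [polyRep, map_sum, map_mul, map_pow, AdjoinRoot.mk_C, AdjoinRoot.mk_X]

theorem polyRep_coeff {n : ℕ} (α : A) {g : A[X]} (hg : g.natDegree < n) :
    polyRep n α (fun i => g.coeff i) = AdjoinRoot.mk (X ^ n - C α) g := by
  rw [polyRep_eq_mk]
  congr 1
  rw [Fin.sum_univ_eq_sum_range (fun i => C (g.coeff i) * X ^ i)]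
  exact (g.as_sum_range_C_mul_X_pow' hg).symm

theorem polyRep_zero (n : ℕ) (α : A) : polyRep n α 0 = 0 := by
  simp [polyRep]

theorem polyRep_sub (n : ℕ) (α : A) (c d : Fin n → A) :
    polyRep n α (c - d) = polyRep n α c - polyRep n α d := by
  simp only [polyRep, Pi.sub_apply, map_sub, sub_mul, Finset.sum_sub_distrib]

theorem polyRep_injective [Nontrivial A] {n : ℕ} (hn : n ≠ 0) (α : A) :
    Function.Injective (polyRep n α) := by
  intro c d h
  rw [← sub_eq_zero, ← polyRep_sub, polyRep_eq_mk, AdjoinRoot.mk_eq_zero] at h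
  have hz : (∑ i : Fin n, C ((c - d) i) * X ^ (i : ℕ)) = 0 := by
    by_contra hne
    refine (monic_X_pow_sub_C α hn).not_dvd_of_degree_lt hne ?_ h
    rw [degree_X_pow_sub_C (Nat.pos_of_ne_zero hn)]
    exact degree_sum_fin_lt _
  funext j
  have := congrArg (fun q => coeff q (j : ℕ)) hz
  simp only [finsetSum_coeff, coeff_C_mul, coeff_X_pow, coeff_zero, Fin.val_inj, mul_ite, mul_one,
    mul_zero, Finset.sum_ite_eq, Finset.mem_univ, if_true] at this
  exact sub_eq_zero.1 this

theorem polyRep_smul (n : ℕ) (α a : A) (c : Fin n → A) :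
    polyRep n α (a • c) = AdjoinRoot.of (X ^ n - C α) a * polyRep n α c := by
  simp only [polyRep, Pi.smul_apply, smul_eq_mul, map_mul, mul_assoc, Finset.mul_sum]

open Classical in
theorem dH_eq_sInf_hammingNorm {n : ℕ} {α : A} (I : Ideal (Ambient n α)) :
    dH I = sInf {d | ∃ c, c ≠ 0 ∧ polyRep n α c ∈ I ∧ hammingNorm c = d} := by
  rw [dH, minDist]
  congr 1
  ext d
  constructor
  · rintro ⟨x, hx, y, hy, hxy, rfl⟩
    refine ⟨y - x, sub_ne_zero.2 hxy.symm, ?_, ?_⟩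
    · rw [polyRep_sub]
      exact I.sub_mem hy hx
    · rw [← neg_add_eq_sub]
      convert (hammingDist_eq_hammingNorm x y).symm
  · rintro ⟨c, hc, hcI, rfl⟩
    refine ⟨c, hcI, 0, ?_, hc, ?_⟩
    · change polyRep n α 0 ∈ I
      rw [polyRep_zero]
      exact I.zero_mem
    · convert hammingDist_zero_right c

open Classical in
theorem dH_eq_of_hammingNorm {n d : ℕ} {α : A} {I : Ideal (Ambient n α)}
    (hex : ∃ c, c ≠ 0 ∧ polyRep n α c ∈ I ∧ hammingNorm c ≤ d)
    (hle : ∀ c, c ≠ 0 → polyRep n α c ∈ I → d ≤ hammingNorm c) : dH I = d := by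
  rw [dH_eq_sInf_hammingNorm]
  obtain ⟨c, hc, hcI, hcd⟩ := hex
  apply le_antisymm
  · refine (Nat.sInf_le ?_).trans hcd
    exact ⟨c, hc, hcI, rfl⟩
  · obtain ⟨c', hc', hcI', h⟩ := Nat.sInf_mem (s := {d | ∃ c, c ≠ 0 ∧ polyRep n α c ∈ I ∧
      hammingNorm c = d}) ⟨hammingNorm c, c, hc, hcI, rfl⟩
    rw [← h]
    exact hle c' hc' hcI'

open Classical in
theorem dH_eq_dH_of_le {n : ℕ} {α : A} {I J : Ideal (Ambient n α)} (hIJ : I ≤ J)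
    (h : ∀ c, c ≠ 0 → polyRep n α c ∈ J →
      ∃ c', c' ≠ 0 ∧ polyRep n α c' ∈ I ∧ hammingNorm c' ≤ hammingNorm c) : dH J = dH I := by
  by_cases hex : ∃ c, c ≠ 0 ∧ polyRep n α c ∈ I
  · obtain ⟨c, hc, hcI⟩ := hex
    obtain ⟨c', hc', hcI', hcd⟩ := Nat.sInf_mem (s := {d | ∃ c, c ≠ 0 ∧ polyRep n α c ∈ I ∧
      hammingNorm c = d}) ⟨hammingNorm c, c, hc, hcI, rfl⟩
    rw [← dH_eq_sInf_hammingNorm] at hcd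
    refine dH_eq_of_hammingNorm ⟨c', hc', hIJ hcI', hcd.le⟩ fun x hx hxJ => ?_
    obtain ⟨y, hy, hyI, hyx⟩ := h x hx hxJ
    refine le_trans ?_ hyx
    rw [dH_eq_sInf_hammingNorm]
    exact Nat.sInf_le ⟨y, hy, hyI, rfl⟩
  -- Neither code has a nonzero word, so both distances are the infimum of the empty set.
  · have hI : {d | ∃ c, c ≠ 0 ∧ polyRep n α c ∈ I ∧ hammingNorm c = d} = ∅ := by
      ext d
      simp only [Set.mem_ofPred_eq, Set.mem_empty_iff_false, iff_false]
      rintro ⟨c, hc, hcI, _⟩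
      exact hex ⟨c, hc, hcI⟩
    have hJ : {d | ∃ c, c ≠ 0 ∧ polyRep n α c ∈ J ∧ hammingNorm c = d} = ∅ := by
      ext d
      simp only [Set.mem_ofPred_eq, Set.mem_empty_iff_false, iff_false]
      rintro ⟨c, hc, hcJ, _⟩
      obtain ⟨c', hc', hcI', _⟩ := h c hc hcJ
      exact hex ⟨c', hc', hcI'⟩
    rw [dH_eq_sInf_hammingNorm, dH_eq_sInf_hammingNorm, hI, hJ]

open Classical in
theorem hammingNorm_smul_le' {n : ℕ} (a : A) (c : Fin n → A) :
    hammingNorm (a • c) ≤ hammingNorm c := by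
  refine Finset.card_le_card fun i hi => ?_
  simp only [Finset.mem_filter, Finset.mem_univ, true_and, Pi.smul_apply, smul_eq_mul] at hi ⊢
  exact right_ne_zero_of_mul hi

end Words

/-! ### Scalars, squares and the annihilator of `u` in `R` -/

section Scalars

variable {F : Type*} [Field F]

instance instNontrivialR : Nontrivial (R F) :=
  inferInstanceAs (Nontrivial (DualNumber (DualNumber F)))

/-- The inclusion of the scalars as a ring homomorphism. -/
noncomputable def cstHom : F →+* R F where
  toFun := cst
  map_one' := rfl
  map_zero' := rfl
  map_add' a b := by
    apply TrivSqZeroExt.ext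
    · exact TrivSqZeroExt.inl_add F a b
    · exact (add_zero (0 : DualNumber F)).symm
  map_mul' a b := by
    apply TrivSqZeroExt.ext
    · exact TrivSqZeroExt.inl_mul F a b
    · rw [snd_mul]
      change (0 : DualNumber F) = (cst a).fst * 0 + 0 * (cst b).fst
      rw [mul_zero, zero_mul, add_zero]

theorem cstHom_apply (a : F) : cstHom a = cst a := rfl

theorem elt_eq_zero_iff {a b c d : F} : elt a b c d = 0 ↔ a = 0 ∧ b = 0 ∧ c = 0 ∧ d = 0 := by
  have h0 : (0 : R F) = elt 0 0 0 0 := by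
    simp only [elt, ← cstHom_apply, map_zero, zero_mul, add_zero]
  rw [h0]
  constructor
  · intro h
    have := elt_bijective.1 (a₁ := (a, b, c, d)) (a₂ := (0, 0, 0, 0)) h
    simpa using this
  · rintro ⟨rfl, rfl, rfl, rfl⟩
    rfl

theorem cst_mul_u_mul_v_eq_zero_iff {a : F} : cst a * (u * v) = 0 ↔ a = 0 := by
  have h : cst a * (u * v) = elt 0 0 0 a := by
    simp only [elt, ← cstHom_apply, map_zero, zero_mul, zero_add]
  rw [h, elt_eq_zero_iff]
  simp

theorem exists_eq_u_mul_of_u_mul_eq_zero {r : R F} (h : u * r = 0) : ∃ r', r = u * r' := by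
  obtain ⟨⟨a, b, c, d⟩, rfl⟩ := elt_bijective.2 r
  have h1 : u * elt a b c d = elt 0 a 0 c := by
    simp only [elt, ← cstHom_apply, map_zero]
    linear_combination (cstHom b + cstHom d * v) * u_mul_u (F := F)
  simp only [h1, elt_eq_zero_iff] at h
  obtain ⟨-, rfl, -, rfl⟩ := h
  refine ⟨cst b + cst d * v, ?_⟩
  simp only [elt, ← cstHom_apply, map_zero]
  ring

theorem isSquare_elt {a : F} (ha : a ≠ 0) (h2 : (2 : F) ≠ 0) (hsq : IsSquare a) (b c d : F) :
    IsSquare (elt a b c d) := by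
  obtain ⟨e, rfl⟩ := hsq
  have he : e ≠ 0 := left_ne_zero_of_mul ha
  obtain ⟨b', rfl⟩ : ∃ b', 2 * e * b' = b := ⟨b / (2 * e), by field_simp⟩
  obtain ⟨c', rfl⟩ : ∃ c', 2 * e * c' = c := ⟨c / (2 * e), by field_simp⟩
  -- The summand `2 b' c'` is the `uv` coefficient produced by the cross terms `b'u · c'v` of the
  -- square.
  obtain ⟨d', rfl⟩ : ∃ d', 2 * e * d' + 2 * b' * c' = d :=
    ⟨(d - 2 * b' * c') / (2 * e), by field_simp; ring⟩
  refine ⟨elt e b' c' d', ?_⟩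
  simp only [elt, ← cstHom_apply, map_mul, map_add, map_ofNat]
  set e := cstHom e
  set b := cstHom b'
  set c := cstHom c'
  set d := cstHom d'
  have hu := u_mul_u (F := F)
  have hv := v_mul_v (F := F)
  linear_combination (-(b ^ 2 + 2 * b * d * v + d ^ 2 * v * v)) * hu + (-(c ^ 2 + 2 * c * d * u)) * hv

/-- The evaluation of polynomials over `F` at the class of `x`. -/
noncomputable def scalarPoly (n : ℕ) (α : R F) : F[X] →+* Ambient n α :=
  (AdjoinRoot.mk (X ^ n - C α)).comp (mapRingHom cstHom)

theorem scalarPoly_X (n : ℕ) (α : R F) :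
    scalarPoly n α X = AdjoinRoot.root (X ^ n - C α : (R F)[X]) := by
  simp [scalarPoly]

theorem scalarPoly_C (n : ℕ) (α : R F) (a : F) :
    scalarPoly n α (C a) = AdjoinRoot.of (X ^ n - C α : (R F)[X]) (cst a) := by
  simp [scalarPoly, cstHom_apply]

theorem quad_eq (n : ℕ) (α : R F) (a : F) : quad n α a = scalarPoly n α (X ^ 2 - C a) := by
  rw [quad, map_sub, map_pow, scalarPoly_X, scalarPoly_C]

theorem of_mul_scalarPoly {n : ℕ} (α b : R F) {r : F[X]} (hr : r.natDegree < n) :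
    AdjoinRoot.of (X ^ n - C α : (R F)[X]) b * scalarPoly n α r
      = polyRep n α (fun i => b * cst (r.coeff i)) := by
  have h : (r.map cstHom).natDegree < n := (natDegree_map_le).trans_lt hr
  have h1 := polyRep_smul n α b (fun i => (r.map cstHom).coeff i)
  rw [polyRep_coeff α h] at h1
  rw [scalarPoly, RingHom.comp_apply, coe_mapRingHom, ← h1]
  congr 1
  funext i
  simp [cstHom_apply]

open Classical in
theorem hammingNorm_u_mul_v {n : ℕ} {r : F[X]} (hr : r.natDegree < n) :
    hammingNorm (fun i : Fin n => u * v * cst (r.coeff i)) = r.support.card := by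
  rw [hammingNorm]
  refine Finset.card_bij (fun i _ => (i : ℕ)) ?_ ?_ ?_
  · intro i hi
    simp only [Finset.mem_filter, Finset.mem_univ, true_and, mul_comm (u * v),
      Ne, cst_mul_u_mul_v_eq_zero_iff] at hi
    exact mem_support_iff.2 hi
  · intro i _ j _ h
    exact Fin.ext h
  · intro k hk
    refine ⟨⟨k, (le_natDegree_of_mem_supp _ hk).trans_lt hr⟩, ?_, rfl⟩
    simp only [Finset.mem_filter, Finset.mem_univ, true_and, mul_comm (u * v),
      Ne, cst_mul_u_mul_v_eq_zero_iff]
    exact mem_support_iff.1 hk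

end Scalars

/-! ### Multiples of `u` in the ambient ring and their distances -/

section Structure

variable {F : Type*} [Field F]

theorem root_pow {A : Type*} [CommRing A] (n : ℕ) (α : A) :
    AdjoinRoot.root (X ^ n - C α) ^ n = AdjoinRoot.of (X ^ n - C α) α := by
  have h := AdjoinRoot.mk_self (f := X ^ n - C α)
  rwa [map_sub, map_pow, AdjoinRoot.mk_X, AdjoinRoot.mk_C, sub_eq_zero] at h

theorem scalarPoly_quad_pow (p s : ℕ) [Fact p.Prime] [CharP F p] {a a₁ a₂ a₃ a₄ : F}
    (ha : a ^ p ^ s = a₁) {α : R F} (hα : α = elt a₁ a₂ a₃ a₄) :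
    scalarPoly (2 * p ^ s) α ((X ^ 2 - C a) ^ p ^ s)
      = AdjoinRoot.of (X ^ (2 * p ^ s) - C α : (R F)[X])
        (cst a₂ * u + cst a₃ * v + cst a₄ * (u * v)) := by
  rw [X_pow_sub_C_pow_char_pow, ha, map_sub, map_pow, scalarPoly_X, scalarPoly_C, root_pow,
    ← map_sub]
  congr 1
  rw [hα, elt]
  ring

theorem uBar_mul_scalarPoly_quad_pow (p s : ℕ) [Fact p.Prime] [CharP F p] {a a₁ a₂ a₃ a₄ : F}
    (ha : a ^ p ^ s = a₁) {α : R F} (hα : α = elt a₁ a₂ a₃ a₄) :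
    uBar (2 * p ^ s) α * scalarPoly (2 * p ^ s) α ((X ^ 2 - C a) ^ p ^ s)
      = AdjoinRoot.of (X ^ (2 * p ^ s) - C α : (R F)[X]) (cst a₃ * (u * v)) := by
  rw [scalarPoly_quad_pow p s ha hα, uBar, ← map_mul]
  congr 1
  linear_combination (cst a₂ + cst a₄ * v) * u_mul_u (F := F)

theorem of_u_mul_v_mul_scalarPoly_quad_pow (p s : ℕ) [Fact p.Prime] [CharP F p]
    {a a₁ a₂ a₃ a₄ : F} (ha : a ^ p ^ s = a₁) {α : R F} (hα : α = elt a₁ a₂ a₃ a₄) :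
    AdjoinRoot.of (X ^ (2 * p ^ s) - C α : (R F)[X]) (u * v)
      * scalarPoly (2 * p ^ s) α ((X ^ 2 - C a) ^ p ^ s) = 0 := by
  rw [scalarPoly_quad_pow p s ha hα, ← map_mul, ← map_zero (AdjoinRoot.of _)]
  congr 1
  linear_combination (cst a₂ * v + cst a₄ * v ^ 2) * u_mul_u (F := F)
    + cst a₃ * u * v_mul_v (F := F)

theorem exists_uBar_mul_eq_scalarPoly (p s : ℕ) [Fact p.Prime] [CharP F p] {a a₁ a₂ a₃ a₄ : F}
    (ha : a ^ p ^ s = a₁) (h₃ : a₃ ≠ 0) {α : R F} (hα : α = elt a₁ a₂ a₃ a₄)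
    (y : Ambient (2 * p ^ s) α) :
    ∃ g, uBar (2 * p ^ s) α * y = uBar (2 * p ^ s) α * scalarPoly (2 * p ^ s) α g := by
  obtain ⟨G, rfl⟩ := AdjoinRoot.mk_surjective y
  induction G using Polynomial.induction_on' with
  | add G G' h h' =>
    obtain ⟨g, hg⟩ := h
    obtain ⟨g', hg'⟩ := h'
    exact ⟨g + g', by rw [map_add, mul_add, hg, hg', map_add, mul_add]⟩
  | monomial k r =>
    obtain ⟨⟨b, c, d, e⟩, rfl⟩ := elt_bijective.2 r
    -- Times `u`, the coefficient `b + cu + dv + euv` becomes `bu + d uv`, and `uv = a₃⁻¹ u (X² -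
    -- a)^(p^s)`.
    refine ⟨(C b + C (d / a₃) * (X ^ 2 - C a) ^ p ^ s) * X ^ k, ?_⟩
    rw [← C_mul_X_pow_eq_monomial, map_mul, map_mul, map_pow, map_pow, AdjoinRoot.mk_X,
      scalarPoly_X, ← mul_assoc, ← mul_assoc, map_add, map_mul, mul_add,
      mul_left_comm (uBar _ _), uBar_mul_scalarPoly_quad_pow p s ha hα, scalarPoly_C, scalarPoly_C,
      AdjoinRoot.mk_C, uBar, ← map_mul, ← map_mul, ← map_mul, ← map_add]
    congr 2
    have hd : (cst d : R F) = cst (d / a₃) * cst a₃ := by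
      rw [← cstHom_apply, ← cstHom_apply, ← cstHom_apply, ← map_mul, div_mul_cancel₀ _ h₃]
    simp only [elt]
    rw [hd]
    linear_combination (cst c + cst e * v) * u_mul_u (F := F)

/-- The gcd of `g` and `h^N` is `h^k` up to a unit, and Bézout with `u h^N = 0` puts `u h^k` in `K`.
Hence `i ≤ k`, so `h^i` divides `g`. -/
theorem uBar_mul_scalarPoly_mem_span {n N i : ℕ} {α : R F} {h : F[X]} (hirr : Irreducible h)
    (hnil : uBar n α * scalarPoly n α (h ^ N) = 0) {K : Ideal (Ambient n α)}
    (hi : i ∈ lowerBounds {j : ℕ | uBar n α * scalarPoly n α h ^ j ∈ K}) {g : F[X]}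
    (hg : uBar n α * scalarPoly n α g ∈ K) :
    uBar n α * scalarPoly n α g ∈ Ideal.span {uBar n α * scalarPoly n α h ^ i} := by
  classical
  obtain ⟨k, -, hk⟩ := (dvd_prime_pow hirr.prime N).1 (EuclideanDomain.gcd_dvd_right g (h ^ N))
  have h1 : h ^ k ∣ g := hk.symm.dvd.trans (EuclideanDomain.gcd_dvd_left _ _)
  obtain ⟨w, hw⟩ := hk.dvd
  have hbez := EuclideanDomain.gcd_eq_gcd_ab g (h ^ N)
  have hmem : uBar n α * scalarPoly n α h ^ k ∈ K := by
    rw [← map_pow, hw, hbez, map_mul, map_add, map_mul, map_mul]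
    have : uBar n α * ((scalarPoly n α g * scalarPoly n α (EuclideanDomain.gcdA g (h ^ N))
        + scalarPoly n α (h ^ N) * scalarPoly n α (EuclideanDomain.gcdB g (h ^ N)))
          * scalarPoly n α w)
        = scalarPoly n α (EuclideanDomain.gcdA g (h ^ N)) * scalarPoly n α w
          * (uBar n α * scalarPoly n α g) := by
      linear_combination scalarPoly n α (EuclideanDomain.gcdB g (h ^ N)) * scalarPoly n α w * hnil
    rw [this]
    exact K.mul_mem_left _ hg
  have hik : i ≤ k := hi hmem
  obtain ⟨g', rfl⟩ := (pow_dvd_pow h hik).trans h1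
  rw [Ideal.mem_span_singleton, map_mul, map_pow, ← mul_assoc]
  exact dvd_mul_right _ _

open Classical in
theorem dH_eq_dH_span_uBar_mul {n : ℕ} {α : R F} {K : Ideal (Ambient n α)}
    {x : Ambient n α} (hx : uBar n α * x ∈ K)
    (h : ∀ y, uBar n α * y ∈ K → uBar n α * y ∈ Ideal.span {uBar n α * x}) :
    dH K = dH (Ideal.span {uBar n α * x}) := by
  refine dH_eq_dH_of_le ((Ideal.span_singleton_le_iff_mem _).2 hx) fun c hc hcK => ?_
  by_cases hu : (u : R F) • c = 0
  · have hd (j : Fin n) : ∃ r, c j = u * r :=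
      exists_eq_u_mul_of_u_mul_eq_zero (congrFun hu j)
    choose d hd using hd
    have hcd : c = (u : R F) • d := funext hd
    refine ⟨c, hc, ?_, le_rfl⟩
    rw [hcd, polyRep_smul] at hcK ⊢
    exact h _ hcK
  · refine ⟨(u : R F) • c, hu, ?_, hammingNorm_smul_le' _ _⟩
    rw [polyRep_smul]
    exact h _ (K.mul_mem_left _ hcK)

theorem dH_eq_one_of_of_mem {A : Type*} [CommRing A] {n : ℕ} (hn : 0 < n) {α b : A} (hb : b ≠ 0)
    {K : Ideal (Ambient n α)} (h : AdjoinRoot.of (X ^ n - C α) b ∈ K) : dH K = 1 := by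
  classical
  refine dH_eq_of_hammingNorm ⟨Pi.single ⟨0, hn⟩ b, ?_, ?_, ?_⟩ fun c hc _ => ?_
  · rwa [Ne, Pi.single_eq_zero_iff]
  · have : polyRep n α (Pi.single ⟨0, hn⟩ b) = AdjoinRoot.of (X ^ n - C α) b := by
      rw [polyRep, Finset.sum_eq_single ⟨0, hn⟩]
      · simp
      · intro j _ hj
        rw [Pi.single_eq_of_ne hj, map_zero, zero_mul]
      · intro h
        exact absurd (Finset.mem_univ _) h
    rwa [this]
  · refine Finset.card_le_one.2 fun x hx y hy => ?_
    have key : ∀ z : Fin n, (Pi.single (⟨0, hn⟩ : Fin n) b : Fin n → A) z ≠ 0 → z = ⟨0, hn⟩ := by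
      intro z hz
      by_contra hne
      exact hz (Pi.single_eq_of_ne hne _)
    rw [key x (Finset.mem_filter.1 hx).2, key y (Finset.mem_filter.1 hy).2]
  · rw [Nat.one_le_iff_ne_zero]
    exact hammingNorm_ne_zero_iff.2 hc

theorem dH_span_uBar_mul_quad_pow (p σ γ : ℕ) [Fact p.Prime] [CharP F p] {a a₁ a₂ a₃ a₄ : F}
    (ha : a ^ p ^ (σ + 1 + γ) = a₁) (ha0 : a ≠ 0) (h₃ : a₃ ≠ 0) {α : R F}
    (hα : α = elt a₁ a₂ a₃ a₄) {Γ j : ℕ} (hΓ : 1 ≤ Γ) (hΓp : Γ < p)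
    (hj : p ^ (σ + 1 + γ) - p ^ (σ + 1) + (Γ - 1) * p ^ σ + 1 ≤ j)
    (hj' : j ≤ p ^ (σ + 1 + γ) - p ^ (σ + 1) + Γ * p ^ σ) :
    dH (Ideal.span {uBar (2 * p ^ (σ + 1 + γ)) α
      * scalarPoly (2 * p ^ (σ + 1 + γ)) α (X ^ 2 - C a) ^ (p ^ (σ + 1 + γ) + j)})
      = (Γ + 1) * p ^ γ := by
  classical
  have hp := (Fact.out : p.Prime).pos
  set s := σ + 1 + γ with hs
  set n := 2 * p ^ s with hn
  set J := p ^ s - p ^ (σ + 1) + Γ * p ^ σ with hJ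
  set h : F[X] := X ^ 2 - C a with hh
  have hps : 0 < p ^ s := Nat.pow_pos hp
  have hle : p ^ (σ + 1) ≤ p ^ s := Nat.pow_le_pow_right hp (by omega)
  have hlt : Γ * p ^ σ < p ^ (σ + 1) := by
    rw [pow_succ, mul_comm]
    exact Nat.mul_lt_mul_of_pos_left hΓp (Nat.pow_pos hp)
  have hJs : J < p ^ s := by omega
  have hh0 : h ≠ 0 := X_pow_sub_C_ne_zero (by norm_num) a
  have hmon : (h ^ p ^ s).Monic := (monic_X_pow_sub_C a (by norm_num)).pow _
  have hdegpow (k : ℕ) : (h ^ k).natDegree = 2 * k := by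
    rw [natDegree_pow, natDegree_X_pow_sub_C, mul_comm]
  have hgen : uBar n α * scalarPoly n α h ^ (p ^ s + j)
      = AdjoinRoot.of _ (u * v) * scalarPoly n α (C a₃ * h ^ j) := by
    rw [pow_add, ← map_pow, ← map_pow, ← mul_assoc, uBar_mul_scalarPoly_quad_pow p s ha hα,
      map_mul (scalarPoly n α), scalarPoly_C, map_mul (AdjoinRoot.of _) (cst a₃)]
    ring
  have hword {r : F[X]} (hr : r.natDegree < n) :
      AdjoinRoot.of (X ^ n - C α : (R F)[X]) (u * v) * scalarPoly n α r
        = polyRep n α (fun i => u * v * cst (r.coeff i)) := of_mul_scalarPoly α (u * v) hr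
  -- The light word is `uv h^J`, with `J` the top of the range, where the number of terms is
  -- controlled.
  refine dH_eq_of_hammingNorm ⟨fun i => u * v * cst ((h ^ J).coeff i), ?_, ?_, ?_⟩ ?_
  · intro h0
    have h1 := hammingNorm_u_mul_v (n := n) (r := h ^ J) (by rw [hdegpow]; omega)
    rw [h0, hammingNorm_zero] at h1
    exact (support_nonempty.2 (pow_ne_zero J hh0)).card_ne_zero h1.symm
  · rw [← hword (by rw [hdegpow]; omega), hgen, Ideal.mem_span_singleton]
    refine ⟨scalarPoly n α (C a₃⁻¹ * h ^ (J - j)), ?_⟩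
    rw [mul_assoc, ← map_mul]
    congr 2
    have h1 : h ^ J = h ^ j * h ^ (J - j) := by rw [← pow_add, Nat.add_sub_cancel' hj']
    have h2 : C a₃ * C a₃⁻¹ = (1 : F[X]) := by rw [← C_mul, mul_inv_cancel₀ h₃, C_1]
    linear_combination h1 - h ^ j * h ^ (J - j) * h2
  · rw [hammingNorm_u_mul_v (by rw [hdegpow]; omega)]
    exact card_support_pow_le p 2 a Γ σ γ
  · intro c hc hcK
    rw [hgen, Ideal.mem_span_singleton] at hcK
    obtain ⟨y, hy⟩ := hcK
    obtain ⟨g, hg⟩ := exists_uBar_mul_eq_scalarPoly p s ha h₃ hα y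
    -- Since `uv h^(p^s) = 0`, only the residue mod `h^(p^s)` counts; it keeps the factor `h^j`
    -- because `j ≤ J < p^s`.
    obtain ⟨r, hr⟩ : ∃ r, r = (C a₃ * h ^ j * g) %ₘ h ^ p ^ s := ⟨_, rfl⟩
    have hdiv := modByMonic_add_div (C a₃ * h ^ j * g) (h ^ p ^ s)
    rw [← hr] at hdiv
    have hrdeg : r.natDegree < n := by
      have := natDegree_modByMonic_lt (C a₃ * h ^ j * g) hmon (fun h1 => by
        have := congrArg natDegree h1
        rw [hdegpow, natDegree_one] at this
        omega)
      rw [← hr, hdegpow] at this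
      exact this
    have hrdvd : h ^ j ∣ r := by
      rw [← eq_sub_iff_add_eq] at hdiv
      rw [hdiv]
      refine dvd_sub (Dvd.dvd.mul_right (dvd_mul_left _ _) _) (Dvd.dvd.mul_right ?_ _)
      exact pow_dvd_pow _ (by omega)
    have hcr : c = fun i : Fin n => u * v * cst (r.coeff i) := by
      refine polyRep_injective (by omega) α ?_
      rw [← hword hrdeg, hy]
      have h0 := of_u_mul_v_mul_scalarPoly_quad_pow p s ha hα
      rw [uBar] at hg
      have hd := congrArg (scalarPoly n α) hdiv
      simp only [map_mul, map_add] at hd h0 ⊢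
      linear_combination AdjoinRoot.of _ v * scalarPoly n α (C a₃) * scalarPoly n α (h ^ j) * hg
        - AdjoinRoot.of _ u * AdjoinRoot.of _ v * hd
        + scalarPoly n α (C a₃ * h ^ j * g /ₘ h ^ p ^ s) * h0
    have hr0 : r ≠ 0 := by
      rintro rfl
      apply hc
      rw [hcr]
      funext i
      simp [← cstHom_apply]
    rw [hcr, hammingNorm_u_mul_v hrdeg]
    exact le_card_support_of_pow_dvd p (by norm_num) ha0 hΓ σ γ r hr0 hrdeg
      ((pow_dvd_pow _ hj).trans hrdvd)

end Structure

/-! ### Exhaustiveness of the ranges, and arithmetic of the finite field -/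

theorem exists_inRange {p s i : ℕ} (hp : 1 < p) (hi : p ^ s < i) (hi' : i < 2 * p ^ s) :
    ∃ Γ γ, InRange p s Γ γ i := by
  obtain ⟨k, hk⟩ : ∃ k, k = 2 * p ^ s - i := ⟨_, rfl⟩
  have hk0 : k ≠ 0 := by omega
  have h1 := Nat.pow_log_le_self p hk0
  have h2 := Nat.lt_pow_succ_log_self hp k
  obtain ⟨e, he⟩ : ∃ e, e = Nat.log p k := ⟨_, rfl⟩
  rw [Nat.succ_eq_add_one, ← he] at h2
  rw [← he] at h1
  have hes : e < s := by
    by_contra h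
    have := Nat.pow_le_pow_right (by omega : 0 < p) (not_lt.1 h)
    omega
  have hpe : 0 < p ^ e := Nat.pow_pos (by omega)
  obtain ⟨d, hd⟩ : ∃ d, d = k / p ^ e := ⟨_, rfl⟩
  have hd1 : 1 ≤ d := by rw [hd]; exact Nat.div_pos h1 hpe
  have hdp : d < p := by
    rw [hd, Nat.div_lt_iff_lt_mul hpe, mul_comm, ← pow_succ]
    exact h2
  have hdk : d * p ^ e ≤ k := by rw [hd]; exact Nat.div_mul_le_self _ _
  have hkd : k < d * p ^ e + p ^ e := by
    rw [hd, ← Nat.succ_mul, Nat.succ_eq_add_one, ← Nat.div_lt_iff_lt_mul hpe]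
    exact Nat.lt_succ_self _
  have hle : p ^ (e + 1) ≤ p ^ s := Nat.pow_le_pow_right (by omega) (by omega)
  -- The range for `Γ`, `γ` says exactly that `k = 2p^s - i` satisfies `d p^e ≤ k < (d + 1) p^e`,
  -- where `d` is the leading base-`p` digit of `k`.
  refine ⟨p - d, s - 1 - e, by omega, by omega, by omega, ?_⟩
  have e1 : s - (s - 1 - e) = e + 1 := by omega
  rw [e1, Nat.add_sub_cancel]
  have h3 : (p - d) * p ^ e + d * p ^ e = p ^ (e + 1) := by
    rw [← add_mul, Nat.sub_add_cancel hdp.le, pow_succ, mul_comm]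
  have h4 : (p - d - 1) * p ^ e + p ^ e = (p - d) * p ^ e := by
    rw [← Nat.succ_mul, Nat.succ_eq_add_one, Nat.sub_add_cancel (by omega)]
  omega

/-- The combined exponent of `p` is a multiple of `m`, and `a ^ p^m = a` in `F`. -/
theorem alpha0_pow {F : Type*} [Field F] {p m : ℕ} (hF : Nat.card F = p ^ m) (hp : 0 < p) (s : ℕ)
    (a : F) : alpha0 p m s a ^ p ^ s = a := by
  have hfin : Finite F := Nat.finite_of_card_ne_zero (by rw [hF]; exact (Nat.pow_pos hp).ne')
  have := Fintype.ofFinite F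
  have hm : 0 < m := by
    rcases Nat.eq_zero_or_pos m with rfl | h
    · have := Finite.one_lt_card (α := F)
      rw [hF, pow_zero] at this
      omega
    · exact h
  rw [alpha0, ← pow_mul, ← pow_add]
  have h1 : m - s % m + s = m * (s / m + 1) := by
    have := Nat.mod_lt s hm
    have := Nat.div_add_mod s m
    rw [mul_add]
    omega
  rw [h1, pow_mul, ← hF, Nat.card_eq_fintype_card]
  exact FiniteField.pow_card_pow _ a

theorem charP_of_natCard_eq_pow {F : Type*} [Field F] {p m : ℕ} (hp : p.Prime)
    (hF : Nat.card F = p ^ m) : CharP F p := by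
  have hfin : Finite F := Nat.finite_of_card_ne_zero (by rw [hF]; exact (Nat.pow_pos hp.pos).ne')
  have := Fintype.ofFinite F
  have h : ((p ^ m : ℕ) : F) = 0 := by
    rw [← hF, Nat.card_eq_fintype_card]
    exact Nat.cast_card_eq_zero F
  rw [Nat.cast_pow] at h
  exact (CharP.charP_iff_prime_eq_zero hp).2 (eq_zero_of_pow_eq_zero h)

end Constacyclic

/-! ### The main theorem -/

theorem theorem5 {F : Type*} [Field F] (p m s : ℕ) (hp : p.Prime) (hp2 : p ≠ 2)
    (hs : 0 < s) (hF : Nat.card F = p ^ m)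
    (α₁ α₂ α₃ α₄ : F) (h₁ : α₁ ≠ 0) (h₂ : α₂ ≠ 0) (h₃ : α₃ ≠ 0)
    (α : Constacyclic.R F) (hα : α = Constacyclic.elt α₁ α₂ α₃ α₄) (hsq : ¬ IsSquare α)
    (f U z : Constacyclic.Ambient (2 * p ^ s) α)
    (hf : f = Constacyclic.quad (2 * p ^ s) α (Constacyclic.alpha0 p m s α₁))
    (hU : U = Constacyclic.uBar (2 * p ^ s) α)
    (hz : z = 0 ∨ IsUnit z)
    (l t : ℕ) (hl : l ≤ 2 * p ^ s - 1) (ht : t < l)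
    (K : Ideal (Constacyclic.Ambient (2 * p ^ s) α))
    (hK : K = Ideal.span {f ^ l + U * f ^ t * z}) :
    ∃ i : ℕ, IsLeast {j : ℕ | U * f ^ j ∈ K} i ∧
      Constacyclic.dH K = Constacyclic.dH (Ideal.span {U * f ^ i}) ∧
      (i ≤ p ^ s ∨ ∃ Γ γ : ℕ, Constacyclic.InRange p s Γ γ i) ∧
      (i ≤ p ^ s → Constacyclic.dH K = 1) ∧
      (∀ Γ γ : ℕ, Constacyclic.InRange p s Γ γ i →
        Constacyclic.dH K = (Γ + 1) * p ^ γ) := by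
  open Constacyclic in
  classical
  have : Fact p.Prime := ⟨hp⟩
  have : CharP F p := charP_of_natCard_eq_pow hp hF
  obtain ⟨a, ha⟩ : ∃ a, a = alpha0 p m s α₁ := ⟨_, rfl⟩
  have hpow : a ^ p ^ s = α₁ := by rw [ha]; exact alpha0_pow hF hp.pos s α₁
  have hps : 0 < p ^ s := Nat.pow_pos hp.pos
  have ha0 : a ≠ 0 := by
    rintro rfl
    exact h₁ (by rw [← hpow, zero_pow hps.ne'])
  have h2 : (2 : F) ≠ 0 := by
    intro h
    have h1 := (CharP.cast_eq_zero_iff F p 2).1 (by exact_mod_cast h)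
    exact hp2 ((Nat.prime_dvd_prime_iff_eq hp Nat.prime_two).1 h1)
  have hasq : ¬ IsSquare a := fun h =>
    hsq (hα ▸ isSquare_elt h₁ h2 (hpow ▸ h.pow _) α₂ α₃ α₄)
  have hirr : Irreducible (X ^ 2 - C a) := by
    rw [X_pow_sub_C_irreducible_iff_of_prime Nat.prime_two]
    intro b hb
    exact hasq ⟨b, by rw [← hb, sq]⟩
  rw [← ha, quad_eq] at hf
  subst hf hU
  have huf : uBar (2 * p ^ s) α * scalarPoly (2 * p ^ s) α ((X ^ 2 - C a) ^ (2 * p ^ s)) = 0 := by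
    have h1 := uBar_mul_scalarPoly_quad_pow p s hpow hα
    have h2 := of_u_mul_v_mul_scalarPoly_quad_pow p s hpow hα
    have h3 : (X ^ 2 - C a) ^ (2 * p ^ s) = (X ^ 2 - C a) ^ p ^ s * (X ^ 2 - C a) ^ p ^ s := by
      rw [two_mul, pow_add]
    rw [h3, map_mul, ← mul_assoc, h1, map_mul, mul_assoc, h2, mul_zero]
  -- Multiplying the generator by `u` kills its second term.
  have hlK : uBar (2 * p ^ s) α * scalarPoly (2 * p ^ s) α (X ^ 2 - C a) ^ l ∈ K := by
    have h1 : uBar (2 * p ^ s) α * uBar (2 * p ^ s) α = 0 := by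
      rw [uBar, ← map_mul, u_mul_u, map_zero]
    rw [hK, Ideal.mem_span_singleton]
    exact ⟨uBar (2 * p ^ s) α, by
      linear_combination (-(scalarPoly (2 * p ^ s) α (X ^ 2 - C a) ^ t * z)) * h1⟩
  have hex : ∃ j, uBar (2 * p ^ s) α * scalarPoly (2 * p ^ s) α (X ^ 2 - C a) ^ j ∈ K := ⟨l, hlK⟩
  have hleast : IsLeast {j : ℕ | uBar (2 * p ^ s) α *
      scalarPoly (2 * p ^ s) α (X ^ 2 - C a) ^ j ∈ K} (Nat.find hex) :=
    ⟨Nat.find_spec hex, fun j hj => Nat.find_min' hex hj⟩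
  -- With `l ≤ 2p^s - 1` this keeps `i < 2p^s`, as exhaustiveness requires.
  have hil : Nat.find hex ≤ l := Nat.find_min' hex hlK
  generalize Nat.find hex = i at hleast hil
  have hdist : dH K = dH (Ideal.span {uBar (2 * p ^ s) α *
      scalarPoly (2 * p ^ s) α (X ^ 2 - C a) ^ i}) := by
    refine dH_eq_dH_span_uBar_mul hleast.1 fun y hy => ?_
    obtain ⟨g, hg⟩ := exists_uBar_mul_eq_scalarPoly p s hpow h₃ hα y
    rw [hg] at hy ⊢
    exact uBar_mul_scalarPoly_mem_span hirr huf hleast.2 hy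
  refine ⟨i, hleast, hdist, ?_, fun hi => ?_, fun Γ γ hr => ?_⟩
  · by_cases hi : i ≤ p ^ s
    · exact Or.inl hi
    · exact Or.inr (exists_inRange hp.one_lt (by omega) (by omega))
  · refine dH_eq_one_of_of_mem (by omega) (b := cst α₃ * (u * v))
      (fun h => h₃ (cst_mul_u_mul_v_eq_zero_iff.1 h)) ?_
    have h3 : (X ^ 2 - C a) ^ p ^ s = (X ^ 2 - C a) ^ (p ^ s - i) * (X ^ 2 - C a) ^ i := by
      rw [← pow_add, Nat.sub_add_cancel hi]
    rw [← uBar_mul_scalarPoly_quad_pow p s hpow hα, h3, map_mul, map_pow _ _ i, mul_left_comm]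
    exact K.mul_mem_left _ hleast.1
  · obtain ⟨hΓ, hΓp, hγ, hlo, hhi⟩ := hr
    obtain ⟨σ, rfl⟩ : ∃ σ, s = σ + 1 + γ := ⟨s - γ - 1, by omega⟩
    rw [show σ + 1 + γ - γ = σ + 1 by omega, Nat.add_sub_cancel] at hlo hhi
    -- This makes the truncated subtractions genuine, so removing `p^s` from `i` turns the range
    -- into the one for `j`.
    have hle : p ^ (σ + 1) ≤ p ^ (σ + 1 + γ) := Nat.pow_le_pow_right hp.pos (by omega)
    obtain ⟨j, rfl⟩ : ∃ j, i = p ^ (σ + 1 + γ) + j := ⟨i - p ^ (σ + 1 + γ), by omega⟩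
    rw [hdist]
    exact dH_span_uBar_mul_quad_pow p σ γ hpow ha0 h₃ hα hΓ (by omega) (by omega) (by omega)
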